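/- Let $n\ge 1$ and $\tau,\alpha>0$. A partition is $\lambda\in\mathbb Z^n$ with $\lambda_1\ge\cdots\ge\lambda_n\ge 0$; put $|\lambda|=\sum_i\lambda_i$ and let $a_\lambda(s)$, $l_\lambda(s)$, $a'(s)=j-1$, $l'(s)=i-1$ be the arm, leg, coarm and coleg of a box $s=(i,j)$ of its diagram. The Okounkov polynomial is $$P_\lambda(x;\tau,\alpha)=\sum_T\psi_T\prod_{s\in\lambda}\Big[x_{T(s)}^2-\big(a'(s)+\tau(n-T(s)-l'(s))+\alpha\big)^2\Big],$$ where $T$ runs over the reverse tableaux of shape $\lambda$ with entries in $\{1,\dots,n\}$ (strictly decreasing down columns, weakly decreasing along rows). Here $\psi_T=\prod_{i=1}^n\psi_{\lambda^{(i-1)}\setminus\lambda^{(i)}}$ with $\lambda^{(i)}=\{s : T(s)>i\}$; $\psi_{\lambda\setminus\mu}=\prod_s b_\mu(s)/b_\lambda(s)$ over the boxes $s\in\mu$ with $a_\lambda(s)>a_\mu(s)$ and $l_\lambda(s)=l_\mu(s)$; and $b_\lambda(s)=\frac{\tau l_\lambda(s)+a_\lambda(s)+\tau}{\tau l_\lambda(s)+a_\lambda(s)+1}$.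 Put $q_\lambda=(-1)^{|\lambda|}P_\lambda$. Let $m\ge 0$ be an integer and take $n=2$, $\tau=1$, $\alpha=\frac{m+1}2$ (the parameters of the group $U(m+2,2)$); put $\rho_1=\alpha+1$, $\rho_2=\alpha$. Let $\mathcal C=\{x\in\mathbb R^2: x_1\ge x_2\ge 0\}$, $$\mathcal A_0=\{x\in\mathcal C: q_\lambda(x;1,\alpha)\ge 0\text{ for all partitions }\lambda=(\lambda_1,\lambda_2)\},$$ $$T_1=[0,\alpha]^2\cap\mathcal C,\qquad T_2=[\alpha,\alpha+1]^2\cap\mathcal C,\qquad T_2'=\{x: x_1\ge x_2\ge\rho_2,\ x_1+x_2\le\rho_1+\rho_2\}.$$ Let $s(t)=\dfrac{\sin \pi t}{(t+1)(t+2)\cdots(t+m)}$ (so $s(t)=\sin\pi t$ if $m=0$), let $S(t,u)=\dfrac{s(t)-s(u)}{t-u}$ for $t\ne u$ and $S(t,t)=s'(t)$, and let $$W=\{x\in T_2: S(x_1-\alpha,x_2-\alpha)\ge 0\}.$$ Then $$\mathcal A_0=T_1\cup W.$$ Moreover, the set $W$ is also described by $$W=\{x\in T_2': S(x_1-\alpha,x_2-\alpha)\ge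 0\}=\{x\in T_2': R(x)\ge 0\},\qquad R(x)=\sum_{k=0}^\infty\frac{(\rho_2+x_2)_k(\rho_2-x_2)_k}{(\rho_1+x_1)_k(\rho_1-x_1)_k},$$ where $(a)_k=a(a+1)\cdots(a+k-1)$ and the series converges at every point of $T_2'$ (at the single point $(\rho_1,\rho_2)$ the terms with $k\ge 1$ have the form $0/0$ and are read as $0$). -/

import Mathlib

namespace Okounkov

/-! ### Okounkov polynomials through reverse tableaux

Rows are indexed by `Fin n` and columns by natural numbers, both starting at `0`. A partition with at
most `n` parts is an antitone `l : Fin n → ℕ`, and the box `(i, j)` lies in its diagram when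
`j < l i`. With indices from `0`, the coarm of `(i, j)` is `j` and its coleg is `i`. -/

/-- The arm of the box `(i, j)`, to be used for boxes of the diagram of `l`. -/
def arm {n : ℕ} (l : Fin n → ℕ) (i : Fin n) (j : ℕ) : ℕ := l i - (j + 1)

/-- The leg of the box `(i, j)`: the number of boxes below it in the same column. -/
def leg {n : ℕ} (l : Fin n → ℕ) (i : Fin n) (j : ℕ) : ℕ :=
  (Finset.univ.filter fun k : Fin n => i < k ∧ j < l k).card

/-- The boxes of the diagram of `l`. -/
abbrev Box {n : ℕ} (l : Fin n → ℕ) : Type := Σ i : Fin n, Fin (l i)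

/-- `b_l(s) = (τ · leg + arm + τ) / (τ · leg + arm + 1)`. -/
noncomputable def b {n : ℕ} (τ : ℝ) (l : Fin n → ℕ) (i : Fin n) (j : ℕ) : ℝ :=
  (τ * leg l i j + arm l i j + τ) / (τ * leg l i j + arm l i j + 1)

/-- For diagrams `m ⊆ l`, the product of `b_m(s) / b_l(s)` over the boxes `s` of `m` whose arm is
larger in `l` than in `m` and whose leg is the same in both. -/
noncomputable def psi {n : ℕ} (τ : ℝ) (l m : Fin n → ℕ) : ℝ :=
  ∏ s ∈ (Finset.univ : Finset (Box m)).filter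
      (fun s => arm m s.1 s.2 < arm l s.1 s.2 ∧ leg l s.1 s.2 = leg m s.1 s.2),
    b τ m s.1 s.2 / b τ l s.1 s.2

/-- Reverse tableaux with entries in `Fin n`: strictly decreasing down the columns and weakly
decreasing along the rows. The entry `t : Fin n` stands for the number `t + 1` of `{1, …, n}`. -/
def IsReverseTableau {n : ℕ} (l : Fin n → ℕ) (T : Box l → Fin n) : Prop :=
  (∀ s s' : Box l, s.1 = s'.1 → (s.2 : ℕ) ≤ s'.2 → T s' ≤ T s) ∧
  (∀ s s' : Box l, (s.2 : ℕ) = s'.2 → s.1 < s'.1 → T s' < T s)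

/-- The row lengths of the diagram `{s | T(s) > k}`, for entries numbered from `1`
(that is, `k ≤ T s` for entries numbered from `0`). -/
def level {n : ℕ} (l : Fin n → ℕ) (T : Box l → Fin n) (k : ℕ) : Fin n → ℕ :=
  fun i => (Finset.univ.filter fun j : Fin (l i) => k ≤ (T ⟨i, j⟩ : ℕ)).card

/-- The weight `ψ_T` of a reverse tableau. -/
noncomputable def psiTableau {n : ℕ} (τ : ℝ) (l : Fin n → ℕ) (T : Box l → Fin n) : ℝ :=
  ∏ k : Fin n, psi τ (level l T k) (level l T (k + 1))

open Classical in
/-- The Okounkov (BC type interpolation) polynomial `P_l(x; τ, α)` in `n` variables: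
the sum over reverse tableaux `T` of shape `l` of
`ψ_T ∏_s [x_{T(s)}² - (a'(s) + τ (n - T(s) - l'(s)) + α)²]`, entries of `T` numbered from `1`. -/
noncomputable def P {n : ℕ} (τ α : ℝ) (l : Fin n → ℕ) (x : Fin n → ℝ) : ℝ :=
  ∑ T ∈ (Finset.univ : Finset (Box l → Fin n)).filter (IsReverseTableau l),
    psiTableau τ l T *
      ∏ s : Box l, (x (T s) ^ 2 -
        (((s.2 : ℕ) : ℝ) + τ * ((n : ℝ) - (((T s : ℕ) : ℝ) + 1) - ((s.1 : ℕ) : ℝ)) + α) ^ 2)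

/-- The signed polynomial `q_l = (-1)^{|l|} P_l`. -/
noncomputable def q {n : ℕ} (τ α : ℝ) (l : Fin n → ℕ) (x : Fin n → ℝ) : ℝ :=
  (-1) ^ (∑ i, l i) * P τ α l x

/-- The chamber `x_1 ≥ ⋯ ≥ x_n ≥ 0`. -/
def chamber (n : ℕ) : Set (Fin n → ℝ) := {x | Antitone x ∧ ∀ i, 0 ≤ x i}

/-- The points of the chamber at which every `q_l` is nonnegative. -/
def A₀ (n : ℕ) (τ α : ℝ) : Set (Fin n → ℝ) :=
  {x | x ∈ chamber n ∧ ∀ l : Fin n → ℕ, Antitone l → 0 ≤ q τ α l x}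

/-- `ρ_i = τ (n - i) + α`, for `i` numbered from `1`. -/
def rho (n : ℕ) (τ α : ℝ) (i : Fin n) : ℝ := τ * ((n : ℝ) - (((i : ℕ) : ℝ) + 1)) + α

/-! ### The regions in rank two -/

/-- The triangle `[0, α]² ∩ C`. -/
def T₁ (α : ℝ) : Set (Fin 2 → ℝ) := {x | x ∈ chamber 2 ∧ ∀ i, x i ∈ Set.Icc 0 α}

/-- The triangle `[α, α + 1]² ∩ C`. -/
def T₂ (α : ℝ) : Set (Fin 2 → ℝ) := {x | x ∈ chamber 2 ∧ ∀ i, x i ∈ Set.Icc α (α + 1)}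

/-- The smaller triangle `x_1 ≥ x_2 ≥ ρ_2`, `x_1 + x_2 ≤ ρ_1 + ρ_2`. -/
def T₂' (α : ℝ) : Set (Fin 2 → ℝ) :=
  {x | x 1 ≤ x 0 ∧ rho 2 1 α 1 ≤ x 1 ∧ x 0 + x 1 ≤ rho 2 1 α 0 + rho 2 1 α 1}

/-- `s(t) = sin(πt) / ((t + 1) ⋯ (t + m))`. -/
noncomputable def s (m : ℕ) (t : ℝ) : ℝ :=
  Real.sin (Real.pi * t) / ∏ i ∈ Finset.range m, (t + ((i : ℝ) + 1))

open Classical in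
/-- The symmetric divided difference of `s`. -/
noncomputable def S (m : ℕ) (t u : ℝ) : ℝ :=
  if t = u then deriv (s m) t else (s m t - s m u) / (t - u)

/-- The points of `T₂` with `S(x_1 - α, x_2 - α) ≥ 0`, where `α = (m + 1) / 2`. -/
def W (m : ℕ) : Set (Fin 2 → ℝ) :=
  {x | x ∈ T₂ (((m : ℝ) + 1) / 2) ∧
    0 ≤ S m (x 0 - ((m : ℝ) + 1) / 2) (x 1 - ((m : ℝ) + 1) / 2)}

/-- The `k`-th term `(ρ_2 + x_2)_k (ρ_2 - x_2)_k / ((ρ_1 + x_1)_k (ρ_1 - x_1)_k)`. At the single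
point `(ρ_1, ρ_2)` of `T₂'` the terms with `k ≥ 1` have the form `0 / 0` and count as `0`. -/
noncomputable def RTerm (α : ℝ) (x : Fin 2 → ℝ) (k : ℕ) : ℝ :=
  ((ascPochhammer ℝ k).eval (rho 2 1 α 1 + x 1) * (ascPochhammer ℝ k).eval (rho 2 1 α 1 - x 1)) /
  ((ascPochhammer ℝ k).eval (rho 2 1 α 0 + x 0) * (ascPochhammer ℝ k).eval (rho 2 1 α 0 - x 0))

/-- The hypergeometric sum `R(x) = ∑_k RTerm x k`. -/
noncomputable def R (α : ℝ) (x : Fin 2 → ℝ) : ℝ := ∑' k : ℕ, RTerm α x k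

end Okounkov

/-!
For `τ = 1` all weights `ψ_T` are `1`, and a reverse tableau with two rows is determined by the
number `c` of entries `2` in its first row, so `q_l` is an explicit sum over `c`. On `T₁` all its
summands are nonnegative, and so they are on `T₂` when `l` has two nonempty rows. When `l` has a
single row of length `k`, the sum is a positive multiple of the `k`-th partial sum of `R`; the terms
of `R` after the first are `≤ 0`, so all partial sums are nonnegative exactly when `R ≥ 0`.

The partial sums of `R`, multiplied by `x₁² - x₂²`, telescope. Euler's limit for `Γ` and the
reflection formula then show that `R` is a positive multiple of the divided difference of `s` for
`x₁ ≠ x₂`, and for `x₁ = x₂` by continuity. The shapes `(1)` and `(1, 1)` exclude the points outside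
`T₁` and `T₂`. Finally, on `[0, 1]` the function `s` is `sin πt` times a factor that decreases by
log-convexity of `Γ`, so its divided difference at `t, u` is negative when `t + u > 1`.

Writing `1 / ((t + 1) ⋯ (t + m))` as `Γ(t + 1) / Γ(t + 2α)` extends `s`, and with it the whole
statement, to real `α ≥ 1 / 2`.
-/

namespace Okounkov

open Filter Finset Topology

section Tableaux

theorem b_one {n : ℕ} (l : Fin n → ℕ) (i : Fin n) (j : ℕ) : b 1 l i j = 1 :=
  div_self (by positivity)

theorem psiTableau_one {n : ℕ} (l : Fin n → ℕ) (T : Box l → Fin n) : psiTableau 1 l T = 1 := by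
  simp [psiTableau, psi, b_one]

open Classical in
theorem q_one_eq_sum {n : ℕ} (α : ℝ) (l : Fin n → ℕ) (x : Fin n → ℝ) :
    q 1 α l x = ∑ T : Box l → Fin n with IsReverseTableau l T, ∏ s : Box l,
      (((s.2 : ℕ) + ((n : ℝ) - ((T s : ℕ) + 1) - (s.1 : ℕ)) + α) ^ 2 - x (T s) ^ 2) := by
  have hsign : (-1 : ℝ) ^ (∑ i, l i) = ∏ _s : Box l, (-1 : ℝ) := by simp
  rw [q, P, mul_sum]
  refine sum_congr rfl fun T _ => ?_
  rw [psiTableau_one, one_mul, hsign, ← prod_mul_distrib]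
  exact prod_congr rfl fun s _ => by ring

variable {l : Fin 2 → ℕ}

/-- The filling of a diagram with at most two rows whose first row starts with `c` entries `2` and
whose other entries are `1` (encoded as `1` and `0` in `Fin 2`). It parametrizes the reverse
tableaux of rank two. -/
def rowTableau (l : Fin 2 → ℕ) (c : ℕ) (s : Box l) : Fin 2 :=
  if s.1 = 0 ∧ (s.2 : ℕ) < c then 1 else 0

theorem rowTableau_zero (c : ℕ) (j : Fin (l 0)) :
    rowTableau l c ⟨0, j⟩ = if (j : ℕ) < c then 1 else 0 := by
  simp [rowTableau]

theorem rowTableau_one (c : ℕ) (j : Fin (l 1)) : rowTableau l c ⟨1, j⟩ = 0 := by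
  simp [rowTableau]

theorem isReverseTableau_rowTableau {c : ℕ} (hc : l 1 ≤ c) :
    IsReverseTableau l (rowTableau l c) := by
  constructor
  · rintro ⟨i, j⟩ ⟨_, j'⟩ rfl (hj : (j : ℕ) ≤ j')
    match i with
    | 0 => rw [rowTableau_zero, rowTableau_zero]; split_ifs <;> omega
    | 1 => rw [rowTableau_one, rowTableau_one]
  · rintro ⟨i, j⟩ ⟨i', j'⟩ (hj : (j : ℕ) = j') (hi : i < i')
    obtain ⟨rfl, rfl⟩ : i = 0 ∧ i' = 1 := by omega
    rw [rowTableau_zero, rowTableau_one, if_pos (by omega)]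
    exact Fin.zero_lt_one

theorem injOn_rowTableau (l : Fin 2 → ℕ) : Set.InjOn (rowTableau l) (Set.Iic (l 0)) := by
  intro c hc d hd hcd
  by_contra hne
  wlog hlt : c < d generalizing c d
  · exact this hd hc hcd.symm (Ne.symm hne) (by omega)
  have := congrFun hcd ⟨0, ⟨c, hlt.trans_le hd⟩⟩
  simp [rowTableau_zero, hlt] at this

theorem exists_forall_iff_lt_of_isLowerSet {N : ℕ} {u : Set (Fin N)} (hu : IsLowerSet u) :
    ∃ c ≤ N, ∀ i : Fin N, i ∈ u ↔ (i : ℕ) < c := by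
  rcases hu.eq_univ_or_Iio with rfl | ⟨c, rfl⟩
  · exact ⟨N, le_rfl, fun i => by simp⟩
  · exact ⟨c, c.2.le, fun i => by simp⟩

theorem IsReverseTableau.exists_eq_rowTableau {T : Box l → Fin 2} (hT : IsReverseTableau l T)
    (hl : Antitone l) : ∃ c ∈ Icc (l 1) (l 0), rowTableau l c = T := by
  have h10 : l 1 ≤ l 0 := hl zero_le_one
  have hlower : IsLowerSet {j : Fin (l 0) | T ⟨0, j⟩ = 1} := by
    intro j i hij (hj : T ⟨0, j⟩ = 1)
    have : T ⟨0, j⟩ ≤ T ⟨0, i⟩ := hT.1 ⟨0, i⟩ ⟨0, j⟩ rfl hij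
    simp only [Set.mem_ofPred_eq]
    omega
  obtain ⟨c, hc, hTc⟩ := exists_forall_iff_lt_of_isLowerSet hlower
  simp only [Set.mem_ofPred_eq] at hTc
  have hcol (j : Fin (l 1)) : T ⟨1, j⟩ < T ⟨0, j.castLE h10⟩ :=
    hT.2 ⟨0, j.castLE h10⟩ ⟨1, j⟩ rfl Fin.zero_lt_one
  have hlc : l 1 ≤ c := by
    by_contra! hlt
    have h1 : T ⟨0, (⟨c, hlt⟩ : Fin (l 1)).castLE h10⟩ = 1 := by
      have := hcol ⟨c, hlt⟩
      omega
    exact lt_irrefl c ((hTc _).1 h1)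
  refine ⟨c, mem_Icc.2 ⟨hlc, hc⟩, funext fun ⟨i, j⟩ => ?_⟩
  match i with
  | 0 =>
    rw [rowTableau_zero]
    have := hTc j
    split_ifs <;> omega
  | 1 =>
    rw [rowTableau_one]
    have := hcol j
    omega

end Tableaux

section SqProd

variable {A : Type*}

/-- The product `∏_{j < k} ((a + j)² - x²) = (a + x)_k (a - x)_k`, the building block of the
Okounkov polynomials of rank two and of the terms of the hypergeometric series. -/
def sqProd [CommRing A] (a x : A) (k : ℕ) : A := ∏ j ∈ range k, ((a + j) ^ 2 - x ^ 2)

section CommRing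

variable [CommRing A] (a x : A)

@[simp]
theorem sqProd_zero : sqProd a x 0 = 1 := prod_range_zero _

theorem sqProd_succ (k : ℕ) : sqProd a x (k + 1) = sqProd a x k * ((a + k) ^ 2 - x ^ 2) :=
  prod_range_succ _ _

theorem sqProd_add (c k : ℕ) : sqProd a x (c + k) = sqProd a x c * sqProd (a + c) x k := by
  simp [sqProd, prod_range_add, add_assoc]

theorem sqProd_succ' (k : ℕ) : sqProd a x (k + 1) = (a ^ 2 - x ^ 2) * sqProd (a + 1) x k := by
  rw [add_comm, sqProd_add, Nat.cast_one, sqProd_succ, sqProd_zero, one_mul, Nat.cast_zero,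
    add_zero]

@[simp]
theorem sqProd_self_succ (k : ℕ) : sqProd a a (k + 1) = 0 := by
  rw [sqProd_succ', sub_self, zero_mul]

theorem ascPochhammer_eval_add_mul_eval_sub (k : ℕ) :
    (ascPochhammer A k).eval (a + x) * (ascPochhammer A k).eval (a - x) = sqProd a x k := by
  induction k with
  | zero => simp
  | succ k ih =>
    rw [ascPochhammer_succ_eval, ascPochhammer_succ_eval, sqProd_succ, ← ih]
    ring

end CommRing

section Order

variable [CommRing A] [LinearOrder A] [IsStrictOrderedRing A] {a x y : A}

theorem sqProd_pos (hx : 0 ≤ x) (hxa : x < a) (k : ℕ) : 0 < sqProd a x k :=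
  prod_pos fun j _ => sub_pos.2 <| by
    have : x < a + j := lt_add_of_lt_of_nonneg hxa j.cast_nonneg
    gcongr

theorem sqProd_nonneg (hx : 0 ≤ x) (hxa : x ≤ a) (k : ℕ) : 0 ≤ sqProd a x k :=
  prod_nonneg fun j _ => sub_nonneg.2 <| by
    have : x ≤ a + j := le_add_of_le_of_nonneg hxa j.cast_nonneg
    gcongr

theorem sqProd_anti (hx : 0 ≤ x) (hxy : x ≤ y) (hya : y ≤ a) (k : ℕ) :
    sqProd a y k ≤ sqProd a x k := by
  refine prod_le_prod (fun j _ => sub_nonneg.2 ?_) fun j _ => by gcongr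
  have : y ≤ a + j := le_add_of_le_of_nonneg hya j.cast_nonneg
  have := hx.trans hxy
  gcongr

theorem sqProd_succ_nonpos (ha : 0 ≤ a) (hax : a ≤ x) (hxa : x ≤ a + 1) (k : ℕ) :
    sqProd a x (k + 1) ≤ 0 := by
  rw [sqProd_succ']
  exact mul_nonpos_of_nonpos_of_nonneg (sub_nonpos.2 (by gcongr))
    (sqProd_nonneg (ha.trans hax) hxa k)

end Order

theorem sum_sqProd_div_mul [Field A] {a x y : A} (h : ∀ k, sqProd (a + 1) x k ≠ 0) (k : ℕ) :
    (∑ c ∈ range (k + 1), sqProd a y c / sqProd (a + 1) x c) * (x ^ 2 - y ^ 2) =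
      sqProd a y (k + 1) / sqProd (a + 1) x k + (x ^ 2 - a ^ 2) := by
  induction k with
  | zero => simp [sqProd_succ']
  | succ k ih =>
    have hk := h k
    have hfac : (a + 1 + k) ^ 2 - x ^ 2 ≠ 0 := right_ne_zero_of_mul (sqProd_succ (a + 1) x k ▸ h _)
    rw [sum_range_succ, add_mul, ih, sqProd_succ a y (k + 1), sqProd_succ (a + 1) x k]
    field_simp
    push_cast
    ring

end SqProd

section RankTwo

theorem prod_rowTableau (α : ℝ) {l : Fin 2 → ℕ} (x : Fin 2 → ℝ) {c : ℕ} (hc : c ≤ l 0) :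
    ∏ s : Box l, (((s.2 : ℕ) + (((2 : ℕ) : ℝ) - ((rowTableau l c s : ℕ) + 1) - (s.1 : ℕ)) + α) ^ 2 -
        x (rowTableau l c s) ^ 2) =
      sqProd α (x 0) (l 1) * (sqProd α (x 1) c * sqProd (α + 1 + c) (x 0) (l 0 - c)) := by
  rw [Fintype.prod_sigma, Fin.prod_univ_two, mul_comm]
  congr 1
  · rw [sqProd, prod_range]
    refine prod_congr rfl fun j _ => ?_
    simp only [Fin.isValue, Nat.cast_ofNat, rowTableau_one, Fin.coe_ofNat_eq_mod, Nat.zero_mod,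
      CharP.cast_eq_zero, zero_add, Nat.mod_succ, Nat.cast_one, sub_left_inj]
    ring
  · have hsplit : sqProd α (x 1) c * sqProd (α + 1 + c) (x 0) (l 0 - c) =
        ∏ j ∈ range (l 0), if j < c then (α + j) ^ 2 - x 1 ^ 2 else (α + 1 + j) ^ 2 - x 0 ^ 2 := by
      rw [← prod_range_mul_prod_Ico _ hc, prod_Ico_eq_prod_range]
      congr 1
      · exact prod_congr rfl fun j hj => by rw [if_pos (mem_range.1 hj)]
      · exact prod_congr rfl fun j _ => by simp [add_assoc]
    rw [hsplit, prod_range]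
    refine prod_congr rfl fun j _ => ?_
    rw [rowTableau_zero]
    split_ifs
    · simp only [Fin.isValue, Nat.cast_ofNat, Fin.coe_ofNat_eq_mod, Nat.mod_succ, Nat.cast_one,
        Nat.zero_mod, CharP.cast_eq_zero, sub_zero, sub_left_inj]
      ring
    · simp only [Fin.isValue, Nat.cast_ofNat, Fin.coe_ofNat_eq_mod, Nat.zero_mod,
        CharP.cast_eq_zero, zero_add, sub_zero, sub_left_inj]
      ring

theorem q_rank_two (α : ℝ) {l : Fin 2 → ℕ} (hl : Antitone l) (x : Fin 2 → ℝ) :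
    q 1 α l x = ∑ c ∈ Icc (l 1) (l 0),
      sqProd α (x 0) (l 1) * (sqProd α (x 1) c * sqProd (α + 1 + c) (x 0) (l 0 - c)) := by
  classical
  rw [q_one_eq_sum]
  refine (sum_bij (fun c _ => rowTableau l c) ?_ ?_ ?_ ?_).symm
  · exact fun c hc => (mem_filter_univ _).2 (isReverseTableau_rowTableau (mem_Icc.1 hc).1)
  · exact fun c hc d hd => injOn_rowTableau l (mem_Icc.1 hc).2 (mem_Icc.1 hd).2
  · intro T hT
    obtain ⟨c, hc, h⟩ := ((mem_filter_univ T).1 hT).exists_eq_rowTableau hl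
    exact ⟨c, hc, h⟩
  · exact fun c hc => (prod_rowTableau α x (mem_Icc.1 hc).2).symm

end RankTwo

section Gamma

theorem GammaSeq_neg_natCast {m k : ℕ} (hmk : m ≤ k) : Real.GammaSeq (-m) k = 0 := by
  have : ∏ j ∈ range (k + 1), (-(m : ℝ) + j) = 0 :=
    prod_eq_zero (mem_range.2 (Nat.lt_succ_of_le hmk)) (neg_add_cancel _)
  rw [Real.GammaSeq, this, div_zero]

theorem tendsto_inv_GammaSeq (a : ℝ) :
    Tendsto (fun k => (Real.GammaSeq a k)⁻¹) atTop (𝓝 (Real.Gamma a)⁻¹) := by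
  by_cases ha : Real.Gamma a = 0
  · obtain ⟨m, rfl⟩ := (Real.Gamma_eq_zero_iff a).1 ha
    refine tendsto_const_nhds.congr' ?_
    filter_upwards [eventually_ge_atTop m] with k hk
    rw [GammaSeq_neg_natCast hk, ha]
  · exact (Real.GammaSeq_tendsto_Gamma a).inv₀ ha

/-- The limit of `sqProd a x (k + 1) / (k ^ (2 * a) * k! ^ 2)` as `k → ∞`, an entire function
of `x`. -/
noncomputable def sqProdLim (a x : ℝ) : ℝ := (Real.Gamma (a + x) * Real.Gamma (a - x))⁻¹

theorem sqProdLim_pos {a x : ℝ} (h : |x| < a) : 0 < sqProdLim a x := by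
  obtain ⟨h1, h2⟩ := abs_lt.1 h
  exact inv_pos.2 (mul_pos (Real.Gamma_pos_of_pos (by linarith))
    (Real.Gamma_pos_of_pos (by linarith)))

theorem differentiableAt_Gamma_of_pos {z : ℝ} (hz : 0 < z) : DifferentiableAt ℝ Real.Gamma z :=
  Real.differentiableAt_Gamma fun m => ((neg_nonpos.2 m.cast_nonneg).trans_lt hz).ne'

theorem continuousAt_sqProdLim {a x : ℝ} (h : |x| < a) : ContinuousAt (sqProdLim a) x := by
  obtain ⟨h1, h2⟩ := abs_lt.1 h
  have hadd : ContinuousAt (fun x => Real.Gamma (a + x)) x :=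
    (differentiableAt_Gamma_of_pos (by linarith)).continuousAt.comp' (by fun_prop)
  have hsub : ContinuousAt (fun x => Real.Gamma (a - x)) x :=
    (differentiableAt_Gamma_of_pos (by linarith)).continuousAt.comp' (by fun_prop)
  exact (hadd.mul hsub).inv₀ (inv_pos.1 (sqProdLim_pos h)).ne'

theorem inv_GammaSeq_mul_inv_GammaSeq (a x : ℝ) {k : ℕ} (hk : k ≠ 0) :
    (Real.GammaSeq (a + x) k)⁻¹ * (Real.GammaSeq (a - x) k)⁻¹ =
      sqProd a x (k + 1) / ((k : ℝ) ^ (2 * a) * (k.factorial : ℝ) ^ 2) := by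
  have hprod : sqProd a x (k + 1) =
      (∏ j ∈ range (k + 1), (a + x + j)) * ∏ j ∈ range (k + 1), (a - x + j) := by
    rw [sqProd, ← prod_mul_distrib]
    exact prod_congr rfl fun j _ => by ring
  have hpow : (k : ℝ) ^ (2 * a) = (k : ℝ) ^ (a + x) * (k : ℝ) ^ (a - x) := by
    rw [← Real.rpow_add (by positivity)]
    ring_nf
  rw [Real.GammaSeq, Real.GammaSeq, inv_div, inv_div, div_mul_div_comm, hprod, hpow]
  ring_nf

theorem tendsto_sqProd (a x : ℝ) :
    Tendsto (fun k : ℕ => sqProd a x (k + 1) / ((k : ℝ) ^ (2 * a) * (k.factorial : ℝ) ^ 2)) atTop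
      (𝓝 (sqProdLim a x)) := by
  rw [sqProdLim, mul_inv]
  refine ((tendsto_inv_GammaSeq (a + x)).mul (tendsto_inv_GammaSeq (a - x))).congr' ?_
  filter_upwards [eventually_ne_atTop 0] with k hk
  exact inv_GammaSeq_mul_inv_GammaSeq a x hk

theorem tendsto_sqProd_div_sqProd {a x : ℝ} (hx : sqProdLim a x ≠ 0) (y : ℝ) :
    Tendsto (fun k => sqProd a y k / sqProd a x k) atTop
      (𝓝 (sqProdLim a y / sqProdLim a x)) := by
  rw [← tendsto_add_atTop_iff_nat 1]
  refine ((tendsto_sqProd a y).div (tendsto_sqProd a x) hx).congr' ?_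
  filter_upwards [eventually_ne_atTop 0] with k hk
  exact div_div_div_cancel_right₀ (by positivity) _ _

theorem sin_pi_mul_mul_Gamma_add_one {z : ℝ} (hz : 0 ≤ z) :
    Real.sin (Real.pi * z) * Real.Gamma (z + 1) = Real.pi * z * (Real.Gamma (1 - z))⁻¹ := by
  rcases hz.eq_or_lt with rfl | hz
  · simp
  have hrefl := Real.Gamma_mul_Gamma_one_sub z
  have hΓ : Real.Gamma z ≠ 0 := (Real.Gamma_pos_of_pos hz).ne'
  rw [Real.Gamma_add_one hz.ne']
  by_cases hsin : Real.sin (Real.pi * z) = 0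
  · rw [hsin, div_zero, mul_eq_zero, or_iff_right hΓ] at hrefl
    simp [hsin, hrefl]
  · rw [eq_div_iff hsin] at hrefl
    have hΓ' : Real.Gamma (1 - z) ≠ 0 := by
      intro h
      simp [h, Real.pi_ne_zero.symm] at hrefl
    rw [eq_mul_inv_iff_mul_eq₀ hΓ']
    linear_combination z * hrefl

theorem map_add_map_le_of_convexOn {f : ℝ → ℝ} {D : Set ℝ} (hf : ConvexOn ℝ D f) {p q u v : ℝ}
    (hp : p ∈ D) (hq : q ∈ D) (hpu : p ≤ u) (huq : u ≤ q) (h : u + v = p + q) :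
    f u + f v ≤ f p + f q := by
  obtain ⟨a, b, ha, hb, hab, rfl⟩ : u ∈ segment ℝ p q := by
    rw [segment_eq_Icc (hpu.trans huq)]
    exact ⟨hpu, huq⟩
  obtain rfl : v = b • p + a • q := by
    simp only [smul_eq_mul] at h ⊢
    linear_combination h - (p + q) * hab
  have h1 := hf.2 hp hq ha hb hab
  have h2 := hf.2 hp hq hb ha (by rwa [add_comm])
  simp only [smul_eq_mul] at h1 h2 ⊢
  linear_combination h1 + h2 + (f p + f q) * hab

/-- The quotient `Γ(t + a) / Γ(t + b)`; for `b = a + m` it is `1 / ((t + a) ⋯ (t + a + m - 1))`. -/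
noncomputable def gammaRatio (a b t : ℝ) : ℝ := Real.Gamma (t + a) / Real.Gamma (t + b)

theorem gammaRatio_pos {a b t : ℝ} (ha : 0 < t + a) (hb : 0 < t + b) : 0 < gammaRatio a b t :=
  div_pos (Real.Gamma_pos_of_pos ha) (Real.Gamma_pos_of_pos hb)

theorem differentiableAt_gammaRatio {a b t : ℝ} (ha : 0 < t + a) (hb : 0 < t + b) :
    DifferentiableAt ℝ (gammaRatio a b) t :=
  (differentiableAt_comp_add_const.2 (differentiableAt_Gamma_of_pos ha)).div
    (differentiableAt_comp_add_const.2 (differentiableAt_Gamma_of_pos hb))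
    (Real.Gamma_pos_of_pos hb).ne'

theorem antitoneOn_gammaRatio {a b : ℝ} (hab : a ≤ b) :
    AntitoneOn (gammaRatio a b) (Set.Ioi (-a)) := by
  intro t ht t' ht' htt'
  rw [Set.mem_Ioi, neg_lt_iff_pos_add] at ht ht'
  have hlog := map_add_map_le_of_convexOn Real.convexOn_log_Gamma (p := t + a) (q := t' + b)
    (u := t' + a) (v := t + b) ht (by rw [Set.mem_Ioi]; linarith) (by linarith) (by linarith)
    (by ring)
  have hΓ {z : ℝ} (hz : t + a ≤ z) : 0 < Real.Gamma z := Real.Gamma_pos_of_pos (ht.trans_le hz)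
  have h1 := hΓ le_rfl
  have h2 : 0 < Real.Gamma (t' + a) := hΓ (by linarith)
  have h3 : 0 < Real.Gamma (t + b) := hΓ (by linarith)
  have h4 : 0 < Real.Gamma (t' + b) := hΓ (by linarith)
  simp only [Function.comp_apply] at hlog
  rw [← Real.log_mul h2.ne' h3.ne', ← Real.log_mul h1.ne' h4.ne',
    Real.log_le_log_iff (mul_pos h2 h3) (mul_pos h1 h4)] at hlog
  exact (div_le_div_iff₀ h4 h3).2 hlog

end Gamma

section Series

theorem hasSum_of_tail_nonpos_of_tendsto {f : ℕ → ℝ} (hf : ∀ k, f (k + 1) ≤ 0) {a : ℝ}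
    (h : Tendsto (fun k => ∑ c ∈ range (k + 1), f c) atTop (𝓝 a)) : HasSum f a := by
  have htail : HasSum (fun k => -f (k + 1)) (f 0 - a) := by
    rw [hasSum_iff_tendsto_nat_of_nonneg fun k => neg_nonneg.2 (hf k)]
    refine (h.const_sub (f 0)).congr fun k => ?_
    rw [sum_range_succ', sum_neg_distrib]
    ring
  have := htail.neg
  simp only [neg_neg, neg_sub] at this
  rw [← hasSum_nat_add_iff' 1]
  simpa using this

theorem forall_sum_nonneg_iff_tsum_nonneg {f : ℕ → ℝ} (hf : ∀ k, f (k + 1) ≤ 0)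
    (hsum : Summable f) : (∀ k, 0 ≤ ∑ c ∈ range (k + 1), f c) ↔ 0 ≤ ∑' c, f c := by
  constructor
  · exact ge_of_tendsto' (hsum.hasSum.tendsto_sum_nat.comp (tendsto_add_atTop_nat 1))
  · intro h k
    rw [← hsum.sum_add_tsum_nat_add (k + 1)] at h
    have : ∑' c, f (c + (k + 1)) ≤ 0 := tsum_nonpos fun c => hf (c + k)
    linarith

/-- The terms of the hypergeometric series `R`, as functions of the two coordinates `x ≥ y`. -/
noncomputable def hypTerm (α x y : ℝ) (k : ℕ) : ℝ := sqProd α y k / sqProd (α + 1) x k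

theorem rho_two_one_zero (α : ℝ) : rho 2 1 α 0 = α + 1 := by
  norm_num [rho, add_comm]

theorem rho_two_one_one (α : ℝ) : rho 2 1 α 1 = α := by
  norm_num [rho]

theorem RTerm_eq_hypTerm (α : ℝ) (x : Fin 2 → ℝ) : RTerm α x = hypTerm α (x 0) (x 1) := by
  ext k
  rw [RTerm, hypTerm, rho_two_one_zero, rho_two_one_one, ascPochhammer_eval_add_mul_eval_sub,
    ascPochhammer_eval_add_mul_eval_sub]

theorem hasSum_hypTerm_self (α x : ℝ) : HasSum (hypTerm α x α) 1 := by
  convert hasSum_single (f := hypTerm α x α) 0 fun k hk => ?_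
  · simp [hypTerm]
  · obtain ⟨k, rfl⟩ := Nat.exists_eq_succ_of_ne_zero hk
    rw [hypTerm, sqProd_self_succ, zero_div]

variable {α x y : ℝ}

theorem hypTerm_succ_nonpos (hα : 0 ≤ α) (hx : x ∈ Set.Ico 0 (α + 1))
    (hy : y ∈ Set.Icc α (α + 1)) (k : ℕ) : hypTerm α x y (k + 1) ≤ 0 :=
  div_nonpos_of_nonpos_of_nonneg (sqProd_succ_nonpos hα hy.1 hy.2 k)
    (sqProd_pos hx.1 hx.2 _).le

theorem norm_hypTerm_le_norm {x' : ℝ} (hx : 0 ≤ x) (hxx' : x ≤ x') (hx' : x' < α + 1) (k : ℕ) :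
    ‖hypTerm α x y k‖ ≤ ‖hypTerm α x' y k‖ := by
  have hpos' := sqProd_pos (hx.trans hxx') hx' k
  have hle := sqProd_anti hx hxx' hx'.le k
  rw [hypTerm, hypTerm, norm_div, norm_div, Real.norm_of_nonneg hpos'.le,
    Real.norm_of_nonneg (hpos'.le.trans hle)]
  gcongr

theorem sqProdLim_add_one_pos (hx : x ∈ Set.Ico 0 (α + 1)) : 0 < sqProdLim (α + 1) x :=
  sqProdLim_pos (by rw [abs_of_nonneg hx.1]; exact hx.2)

theorem hasSum_hypTerm (hα : 0 ≤ α) (hx : x ∈ Set.Ico 0 (α + 1)) (hy : y ∈ Set.Icc α (α + 1))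
    (hxy : x ≠ y) :
    HasSum (hypTerm α x y) (((x ^ 2 - α ^ 2) * sqProdLim (α + 1) x -
      (y ^ 2 - α ^ 2) * sqProdLim (α + 1) y) / ((x ^ 2 - y ^ 2) * sqProdLim (α + 1) x)) := by
  have hL := (sqProdLim_add_one_pos hx).ne'
  have hne : x ^ 2 - y ^ 2 ≠ 0 := by
    rwa [sub_ne_zero, Ne, sq_eq_sq₀ hx.1 (hα.trans hy.1)]
  refine hasSum_of_tail_nonpos_of_tendsto (hypTerm_succ_nonpos hα hx hy) ?_
  have hlim := (((tendsto_sqProd_div_sqProd hL y).const_mul (α ^ 2 - y ^ 2)).add_const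
    (x ^ 2 - α ^ 2)).div_const (x ^ 2 - y ^ 2)
  convert hlim using 2 with k
  · rw [eq_div_iff hne]
    simp only [hypTerm]
    rw [sum_sqProd_div_mul fun k => (sqProd_pos hx.1 hx.2 k).ne', sqProd_succ', mul_div_assoc]
  · field_simp
    ring

theorem summable_hypTerm (hα : 0 ≤ α) (hx : x ∈ Set.Ico 0 (α + 1))
    (hy : y ∈ Set.Icc α (α + 1)) : Summable (hypTerm α x y) := by
  rcases ne_or_eq x y with hxy | rfl
  · exact (hasSum_hypTerm hα hx hy hxy).summable
  · obtain ⟨x', hxx', hx'⟩ := exists_between hx.2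
    exact ((hasSum_hypTerm hα ⟨hx.1.trans hxx'.le, hx'⟩ hy hxx'.ne').summable.norm).of_norm_bounded
      (norm_hypTerm_le_norm hx.1 hxx'.le hx')

theorem continuousOn_tsum_hypTerm (hα : 0 ≤ α) (hy : y ∈ Set.Icc α (α + 1)) :
    ContinuousOn (fun x => ∑' k, hypTerm α x y k) (Set.Ico 0 (α + 1)) := by
  intro x hx
  obtain ⟨x', hxx', hx'⟩ := exists_between hx.2
  have hcont : ContinuousOn (fun x => ∑' k, hypTerm α x y k) (Set.Icc 0 x') := by
    refine continuousOn_tsum (fun k => ?_)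
      (summable_hypTerm hα ⟨hx.1.trans hxx'.le, hx'⟩ hy).norm
      fun k z hz => norm_hypTerm_le_norm hz.1 hz.2 hx' k
    refine continuousOn_const.div ?_ fun z hz => (sqProd_pos hz.1 (hz.2.trans_lt hx') k).ne'
    unfold sqProd
    fun_prop
  refine (hcont x ⟨hx.1, hxx'.le⟩).mono_of_mem_nhdsWithin ?_
  filter_upwards [self_mem_nhdsWithin, mem_nhdsWithin_of_mem_nhds (Iio_mem_nhds hxx')]
    with z hz hz'
  exact ⟨hz.1, hz'.le⟩

end Series

section DividedDifference

/-- The function `s` with `1 / ((t + 1) ⋯ (t + m))` replaced by `Γ(t + 1) / Γ(t + 2α)`, which is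
the same for `α = (m + 1) / 2` and makes sense for every real `α`. Its divided difference
`dslope (sGamma α) u t` takes the place of `S`. -/
noncomputable def sGamma (α t : ℝ) : ℝ :=
  Real.sin (Real.pi * t) * gammaRatio 1 (2 * α) t

variable {α x y t u : ℝ}

theorem sGamma_sub_eq (hα : 0 < α) (hx : α ≤ x) :
    sGamma α (x - α) = Real.pi * (x ^ 2 - α ^ 2) * sqProdLim (α + 1) x := by
  have hxα : x + α ≠ 0 := by linarith
  have hΓ : Real.Gamma (x + α) ≠ 0 := (Real.Gamma_pos_of_pos (by linarith)).ne'
  have h1 : α + 1 + x = x + α + 1 := by ring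
  have h2 : x - α + 2 * α = x + α := by ring
  have h3 : 1 - (x - α) = α + 1 - x := by ring
  rw [sGamma, gammaRatio, ← mul_div_assoc, sin_pi_mul_mul_Gamma_add_one (sub_nonneg.2 hx), h2, h3,
    sqProdLim, h1, Real.Gamma_add_one hxα, mul_inv, mul_inv]
  field_simp
  ring

theorem differentiableAt_sGamma (hα : 0 < α) (ht : 0 ≤ t) : DifferentiableAt ℝ (sGamma α) t :=
  DifferentiableAt.mul (by fun_prop)
    (differentiableAt_gammaRatio (by positivity) (by positivity))

theorem dslope_sGamma_of_ne (hα : 0 < α) (hx : x ∈ Set.Ico α (α + 1))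
    (hy : y ∈ Set.Icc α (α + 1)) (hxy : x ≠ y) :
    dslope (sGamma α) (y - α) (x - α) =
      Real.pi * (x + y) * sqProdLim (α + 1) x * ∑' k, hypTerm α x y k := by
  have hx' : x ∈ Set.Ico 0 (α + 1) := ⟨hα.le.trans hx.1, hx.2⟩
  have hL := (sqProdLim_add_one_pos hx').ne'
  have hadd : x + y ≠ 0 := by linarith [hx.1, hy.1]
  have hsub : x - y ≠ 0 := sub_ne_zero.2 hxy
  rw [dslope_of_ne _ (by simpa using hxy), slope_def_field, sGamma_sub_eq hα hx.1,
    sGamma_sub_eq hα hy.1, (hasSum_hypTerm hα.le hx' hy hxy).tsum_eq, sub_sub_sub_cancel_right,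
    sq_sub_sq x y]
  field_simp

-- The diagonal value is the limit of the values off the diagonal.
theorem dslope_sGamma_eq (hα : 0 < α) (hx : x ∈ Set.Ico α (α + 1))
    (hy : y ∈ Set.Icc α (α + 1)) :
    dslope (sGamma α) (y - α) (x - α) =
      Real.pi * (x + y) * sqProdLim (α + 1) x * ∑' k, hypTerm α x y k := by
  rcases ne_or_eq x y with hxy | rfl
  · exact dslope_sGamma_of_ne hα hx hy hxy
  have hsub : Set.Ioo x (α + 1) ⊆ Set.Ico 0 (α + 1) := fun z hz =>
    ⟨hα.le.trans (hx.1.trans hz.1.le), hz.2⟩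
  have hx' : x ∈ Set.Ico 0 (α + 1) := ⟨hα.le.trans hx.1, hx.2⟩
  have hlhs : Tendsto (fun z => dslope (sGamma α) (x - α) (z - α)) (𝓝[Set.Ioo x (α + 1)] x)
      (𝓝 (dslope (sGamma α) (x - α) (x - α))) := by
    have := (continuousAt_dslope_same.2 (differentiableAt_sGamma hα (sub_nonneg.2 hx.1))).comp
      (f := fun z => z - α) (x := x) (by fun_prop)
    exact this.tendsto.mono_left nhdsWithin_le_nhds
  have hrhs : ContinuousWithinAt (fun z => Real.pi * (z + x) * sqProdLim (α + 1) z *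
      ∑' k, hypTerm α z x k) (Set.Ico 0 (α + 1)) x := by
    refine .mul (.mul (by fun_prop) (ContinuousAt.continuousWithinAt ?_))
      (continuousOn_tsum_hypTerm hα.le hy x hx')
    exact continuousAt_sqProdLim (by rw [abs_of_nonneg hx'.1]; exact hx'.2)
  have := left_nhdsWithin_Ioo_neBot hx.2
  refine tendsto_nhds_unique (hlhs.congr' ?_) (hrhs.mono_left (nhdsWithin_mono x hsub))
  filter_upwards [self_mem_nhdsWithin] with z hz
  exact dslope_sGamma_of_ne hα ⟨hx.1.trans hz.1.le, hz.2⟩ hy hz.1.ne'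

theorem dslope_sGamma_nonneg_iff (hα : 0 < α) (hx : x ∈ Set.Ico α (α + 1))
    (hy : y ∈ Set.Icc α (α + 1)) :
    0 ≤ dslope (sGamma α) (y - α) (x - α) ↔ 0 ≤ ∑' k, hypTerm α x y k := by
  have hadd : 0 < x + y := by linarith [hx.1, hy.1]
  have hL := sqProdLim_add_one_pos ⟨hα.le.trans hx.1, hx.2⟩
  rw [dslope_sGamma_eq hα hx hy, mul_nonneg_iff_of_pos_left (by positivity)]

theorem sin_pi_mul_lt_sin_pi_mul (hut : u < t) (ht : t ≤ 1) (h : 1 < t + u) :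
    Real.sin (Real.pi * t) < Real.sin (Real.pi * u) := by
  have hπ := Real.pi_pos
  rw [← sub_neg, Real.sin_sub_sin]
  have hcos : Real.cos ((Real.pi * t + Real.pi * u) / 2) < 0 :=
    Real.cos_neg_of_pi_div_two_lt_of_lt (by nlinarith) (by nlinarith)
  have hsin : 0 < Real.sin ((Real.pi * t - Real.pi * u) / 2) :=
    Real.sin_pos_of_pos_of_lt_pi (by nlinarith) (by nlinarith)
  exact mul_neg_of_pos_of_neg (mul_pos two_pos hsin) hcos

theorem sGamma_lt_sGamma (hα : 1 / 2 ≤ α) (hu : 0 ≤ u) (hut : u < t) (ht : t ≤ 1)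
    (h : 1 < t + u) : sGamma α t < sGamma α u := by
  have hanti := antitoneOn_gammaRatio (show 1 ≤ 2 * α by linarith)
    (show u ∈ Set.Ioi (-1) by rw [Set.mem_Ioi]; linarith)
    (show t ∈ Set.Ioi (-1) by rw [Set.mem_Ioi]; linarith) hut.le
  have hpos : 0 < gammaRatio 1 (2 * α) u := gammaRatio_pos (by linarith) (by linarith)
  have hπ := Real.pi_pos
  have hsin : 0 ≤ Real.sin (Real.pi * t) :=
    Real.sin_nonneg_of_nonneg_of_le_pi (by nlinarith) (by nlinarith)
  calc sGamma α t ≤ Real.sin (Real.pi * t) * gammaRatio 1 (2 * α) u :=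
        mul_le_mul_of_nonneg_left hanti hsin
    _ < sGamma α u := mul_lt_mul_of_pos_right (sin_pi_mul_lt_sin_pi_mul hut ht h) hpos

theorem deriv_sGamma_neg (hα : 1 / 2 ≤ α) (ht : 1 / 2 < t) (ht1 : t ≤ 1) :
    deriv (sGamma α) t < 0 := by
  have hπ := Real.pi_pos
  have hsinderiv : HasDerivAt (fun t => Real.sin (Real.pi * t))
      (Real.cos (Real.pi * t) * Real.pi) t := by
    simpa using ((hasDerivAt_id t).const_mul Real.pi).sin
  have hratio := differentiableAt_gammaRatio (show 0 < t + 1 by linarith)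
    (show 0 < t + 2 * α by linarith)
  have hanti : deriv (gammaRatio 1 (2 * α)) t ≤ 0 := by
    rw [← derivWithin_of_isOpen isOpen_Ioi (show t ∈ Set.Ioi (-1) by rw [Set.mem_Ioi]; linarith)]
    exact (antitoneOn_gammaRatio (by linarith)).derivWithin_nonpos
  have hpos : 0 < gammaRatio 1 (2 * α) t := gammaRatio_pos (by linarith) (by linarith)
  have hcos : Real.cos (Real.pi * t) < 0 :=
    Real.cos_neg_of_pi_div_two_lt_of_lt (by nlinarith) (by nlinarith)
  have hsin : 0 ≤ Real.sin (Real.pi * t) :=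
    Real.sin_nonneg_of_nonneg_of_le_pi (by positivity) (by nlinarith)
  have hderiv := (hsinderiv.mul hratio.hasDerivAt).deriv
  exact hderiv.trans_lt (add_neg_of_neg_of_nonpos
    (mul_neg_of_neg_of_pos (mul_neg_of_neg_of_pos hcos hπ) hpos)
    (mul_nonpos_of_nonneg_of_nonpos hsin hanti))

theorem add_le_one_of_dslope_sGamma_nonneg (hα : 1 / 2 ≤ α) (hu : 0 ≤ u) (hut : u ≤ t)
    (ht : t ≤ 1) (h : 0 ≤ dslope (sGamma α) u t) : t + u ≤ 1 := by
  by_contra! hlt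
  rcases hut.eq_or_lt with rfl | hut
  · rw [dslope_same] at h
    exact h.not_gt (deriv_sGamma_neg hα (by linarith) ht)
  · rw [dslope_of_ne _ hut.ne', slope_def_field] at h
    exact h.not_gt (div_neg_of_neg_of_pos (sub_neg.2 (sGamma_lt_sGamma hα hu hut ht hlt))
      (sub_pos.2 hut))

end DividedDifference

section Regions

variable {α : ℝ} {x : Fin 2 → ℝ}

theorem antitone_fin_two {β : Type*} [Preorder β] {f : Fin 2 → β} : Antitone f ↔ f 1 ≤ f 0 := by
  simp [Fin.antitone_iff_succ_le]

theorem mem_chamber_two_iff : x ∈ chamber 2 ↔ x 1 ≤ x 0 ∧ 0 ≤ x 1 := by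
  simp only [chamber, Set.mem_ofPred_eq, antitone_fin_two, Fin.forall_fin_two]
  exact and_congr_right fun h => and_iff_right_of_imp h.trans'

theorem mem_T₁_iff : x ∈ T₁ α ↔ x 1 ≤ x 0 ∧ 0 ≤ x 1 ∧ x 0 ≤ α := by
  simp only [T₁, mem_chamber_two_iff, Set.mem_ofPred_eq, Fin.forall_fin_two, Set.mem_Icc]
  grind

theorem mem_T₂_iff (hα : 0 ≤ α) : x ∈ T₂ α ↔ x 1 ≤ x 0 ∧ α ≤ x 1 ∧ x 0 ≤ α + 1 := by
  simp only [T₂, mem_chamber_two_iff, Set.mem_ofPred_eq, Fin.forall_fin_two, Set.mem_Icc]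
  grind

theorem mem_T₂'_iff : x ∈ T₂' α ↔ x 1 ≤ x 0 ∧ α ≤ x 1 ∧ x 0 + x 1 ≤ 2 * α + 1 := by
  rw [T₂', Set.mem_ofPred_eq, rho_two_one_zero, rho_two_one_one, show α + 1 + α = 2 * α + 1 by ring]

/-- The triangle `T₂` without its side `x 0 = α + 1`, where the terms of `R` have zero denominators,
except that the corner `(ρ₁, ρ₂) = (α + 1, α)` of that side is kept. On this set the sign of `R`
decides membership in `A₀`. -/
def seriesDomain (α : ℝ) : Set (Fin 2 → ℝ) := {x | x ∈ T₂ α ∧ (x 0 < α + 1 ∨ x 1 = α)}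

theorem T₂'_subset_seriesDomain (hα : 0 ≤ α) : T₂' α ⊆ seriesDomain α := by
  intro x hx
  obtain ⟨h, h1, h01⟩ := mem_T₂'_iff.1 hx
  refine ⟨(mem_T₂_iff hα).2 ⟨h, h1, by linarith⟩, ?_⟩
  rcases h1.eq_or_lt with h1 | h1
  · exact Or.inr h1.symm
  · exact Or.inl (by linarith)

theorem T₂'_subset_T₂ (hα : 0 ≤ α) : T₂' α ⊆ T₂ α := fun _ hx =>
  (T₂'_subset_seriesDomain hα hx).1

theorem coord_mem_of_mem_seriesDomain (hα : 0 ≤ α) (hx : x ∈ seriesDomain α) :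
    x 1 ∈ Set.Icc α (α + 1) ∧ (x 0 ∈ Set.Ico α (α + 1) ∨ x 0 = α + 1 ∧ x 1 = α) := by
  obtain ⟨hT, h⟩ := hx
  obtain ⟨h01, h1, h0⟩ := (mem_T₂_iff hα).1 hT
  refine ⟨⟨h1, h01.trans h0⟩, ?_⟩
  rcases h0.lt_or_eq with h0 | h0
  · exact Or.inl ⟨h1.trans h01, h0⟩
  · exact Or.inr ⟨h0, h.resolve_left h0.not_lt⟩

theorem summable_RTerm (hα : 0 ≤ α) (hx : x ∈ seriesDomain α) : Summable (RTerm α x) := by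
  rw [RTerm_eq_hypTerm]
  obtain ⟨h1, h0 | ⟨-, h1'⟩⟩ := coord_mem_of_mem_seriesDomain hα hx
  · exact summable_hypTerm hα ⟨hα.trans h0.1, h0.2⟩ h1
  · rw [h1']
    exact (hasSum_hypTerm_self α (x 0)).summable

theorem R_nonneg_iff (hα : 0 < α) (hx : x ∈ seriesDomain α) :
    0 ≤ R α x ↔ 0 ≤ dslope (sGamma α) (x 1 - α) (x 0 - α) := by
  rw [R, RTerm_eq_hypTerm]
  obtain ⟨h1, h0 | ⟨h0, h1'⟩⟩ := coord_mem_of_mem_seriesDomain hα.le hx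
  · exact (dslope_sGamma_nonneg_iff hα h0 h1).symm
  · have hslope : dslope (sGamma α) 0 1 = 0 := by
      rw [dslope_of_ne _ one_ne_zero, slope_def_field]
      simp [sGamma]
    rw [h0, h1', (hasSum_hypTerm_self _ _).tsum_eq, sub_self, add_sub_cancel_left, hslope]
    simp

end Regions

section Positivity

variable {α : ℝ} {x : Fin 2 → ℝ} {l : Fin 2 → ℕ}

theorem q_one_zero (α : ℝ) (x : Fin 2 → ℝ) :
    q 1 α ![1, 0] x = (α + 1) ^ 2 - x 0 ^ 2 + (α ^ 2 - x 1 ^ 2) := by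
  rw [q_rank_two _ (antitone_fin_two.2 zero_le_one)]
  simp [← Nat.range_succ_eq_Icc_zero, sum_range_succ, sqProd]

theorem q_one_one (α : ℝ) (x : Fin 2 → ℝ) :
    q 1 α ![1, 1] x = (α ^ 2 - x 0 ^ 2) * (α ^ 2 - x 1 ^ 2) := by
  rw [q_rank_two _ (antitone_fin_two.2 le_rfl)]
  simp [sqProd]

theorem q_one_row (hx : ∀ k, sqProd (α + 1) (x 0) k ≠ 0) (hl : l 1 = 0) :
    q 1 α l x = sqProd (α + 1) (x 0) (l 0) * ∑ c ∈ range (l 0 + 1), hypTerm α (x 0) (x 1) c := by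
  rw [q_rank_two _ (antitone_fin_two.2 (hl ▸ Nat.zero_le _)), hl, mul_sum,
    Nat.range_succ_eq_Icc_zero]
  refine sum_congr rfl fun c hc => ?_
  have hsplit := sqProd_add (α + 1) (x 0) c (l 0 - c)
  rw [Nat.add_sub_cancel' (mem_Icc.1 hc).2] at hsplit
  have := hx c
  rw [hypTerm, hsplit, sqProd_zero]
  field_simp

theorem q_nonneg_of_mem_T₁ (hx : x ∈ T₁ α) (hl : Antitone l) : 0 ≤ q 1 α l x := by
  obtain ⟨h, h1, h0⟩ := mem_T₁_iff.1 hx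
  rw [q_rank_two _ hl]
  refine sum_nonneg fun c _ => mul_nonneg (sqProd_nonneg (h1.trans h) h0 _) (mul_nonneg
    (sqProd_nonneg h1 (h.trans h0) _) (sqProd_nonneg (h1.trans h) ?_ _))
  linarith [c.cast_nonneg (α := ℝ)]

theorem q_nonneg_of_mem_T₂ (hα : 0 ≤ α) (hx : x ∈ T₂ α) (hl : Antitone l) (hl1 : l 1 ≠ 0) :
    0 ≤ q 1 α l x := by
  obtain ⟨h, h1, h0⟩ := (mem_T₂_iff hα).1 hx
  have hnonpos {y : ℝ} {k : ℕ} (hy : α ≤ y) (hy' : y ≤ α + 1) (hk : k ≠ 0) : sqProd α y k ≤ 0 := by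
    obtain ⟨k, rfl⟩ := Nat.exists_eq_succ_of_ne_zero hk
    exact sqProd_succ_nonpos hα hy hy' k
  rw [q_rank_two _ hl]
  refine sum_nonneg fun c hc => ?_
  have hc1 := (mem_Icc.1 hc).1
  rw [← mul_assoc]
  refine mul_nonneg (mul_nonneg_of_nonpos_of_nonpos (hnonpos (h1.trans h) h0 hl1)
    (hnonpos h1 (h.trans h0) (by omega))) (sqProd_nonneg (by linarith) ?_ _)
  linarith [c.cast_nonneg (α := ℝ)]

theorem q_nonneg_of_corner (h0 : x 0 = α + 1) (h1 : x 1 = α) (hα : 0 ≤ α) (hl : Antitone l)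
    (hl1 : l 1 = 0) : 0 ≤ q 1 α l x := by
  rw [q_rank_two _ hl, hl1, h0, h1]
  refine sum_nonneg fun c _ => ?_
  rw [sqProd_zero, one_mul]
  refine mul_nonneg (sqProd_nonneg hα le_rfl c) (sqProd_nonneg (by linarith) ?_ _)
  linarith [c.cast_nonneg (α := ℝ)]

theorem mem_A₀_iff (hα : 0 ≤ α) (hx : x ∈ seriesDomain α) : x ∈ A₀ 2 1 α ↔ 0 ≤ R α x := by
  have hrow : x ∈ A₀ 2 1 α ↔ ∀ l : Fin 2 → ℕ, Antitone l → l 1 = 0 → 0 ≤ q 1 α l x := by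
    refine ⟨fun h l hl _ => h.2 l hl, fun h => ⟨hx.1.1, fun l hl => ?_⟩⟩
    by_cases hl1 : l 1 = 0
    exacts [h l hl hl1, q_nonneg_of_mem_T₂ hα hx.1 hl hl1]
  rw [hrow, R, RTerm_eq_hypTerm]
  obtain ⟨h1, h0 | ⟨h0, h1'⟩⟩ := coord_mem_of_mem_seriesDomain hα hx
  · have h0' : x 0 ∈ Set.Ico 0 (α + 1) := ⟨hα.trans h0.1, h0.2⟩
    have hpos := sqProd_pos h0'.1 h0'.2
    rw [← forall_sum_nonneg_iff_tsum_nonneg (hypTerm_succ_nonpos hα h0' h1)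
      (summable_hypTerm hα h0' h1)]
    have hq {l : Fin 2 → ℕ} (hl1 : l 1 = 0) :
        0 ≤ q 1 α l x ↔ 0 ≤ ∑ c ∈ range (l 0 + 1), hypTerm α (x 0) (x 1) c := by
      rw [q_one_row (fun k => (hpos k).ne') hl1, mul_nonneg_iff_of_pos_left (hpos _)]
    exact ⟨fun h k => (hq (l := ![k, 0]) rfl).1 (h _ (antitone_fin_two.2 k.zero_le) rfl),
      fun h l _ hl1 => (hq hl1).2 (h _)⟩
  · rw [h1', (hasSum_hypTerm_self _ _).tsum_eq]
    exact iff_of_true (fun l hl hl1 => q_nonneg_of_corner h0 h1' hα hl hl1) zero_le_one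

theorem A₀_subset (hα : 0 ≤ α) : A₀ 2 1 α ⊆ T₁ α ∪ seriesDomain α := by
  intro x hx
  obtain ⟨h, h1⟩ := mem_chamber_two_iff.1 hx.1
  rcases le_or_gt (x 0) α with h0 | h0
  · exact Or.inl (mem_T₁_iff.2 ⟨h, h1, h0⟩)
  have hq10 := hx.2 ![1, 0] (antitone_fin_two.2 zero_le_one)
  have hq11 := hx.2 ![1, 1] (antitone_fin_two.2 le_rfl)
  rw [q_one_zero] at hq10
  rw [q_one_one] at hq11
  have hα1 : α ≤ x 1 := by
    by_contra! hlt
    exact hq11.not_gt (mul_neg_of_neg_of_pos (by nlinarith) (by nlinarith))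
  have h0' : x 0 ≤ α + 1 := by nlinarith
  refine Or.inr ⟨(mem_T₂_iff hα).2 ⟨h, hα1, h0'⟩, ?_⟩
  by_contra! hcon
  nlinarith [hα1.lt_of_ne' hcon.2]

end Positivity

section Main

variable {α : ℝ}

/-- The points of `T₂` at which the divided difference of `sGamma α` is nonnegative, the analogue
of `W` for real `α`. -/
def WGamma (α : ℝ) : Set (Fin 2 → ℝ) :=
  {x | x ∈ T₂ α ∧ 0 ≤ dslope (sGamma α) (x 1 - α) (x 0 - α)}

theorem WGamma_eq_dslope (hα : 1 / 2 ≤ α) :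
    WGamma α = {x | x ∈ T₂' α ∧ 0 ≤ dslope (sGamma α) (x 1 - α) (x 0 - α)} := by
  have hα0 : 0 ≤ α := by linarith
  ext x
  refine and_congr_left fun h => ⟨fun hx => ?_, fun hx => T₂'_subset_T₂ hα0 hx⟩
  obtain ⟨h01, h1, h0⟩ := (mem_T₂_iff hα0).1 hx
  have := add_le_one_of_dslope_sGamma_nonneg hα (by linarith) (by linarith) (by linarith) h
  exact mem_T₂'_iff.2 ⟨h01, h1, by linarith⟩

theorem WGamma_eq_R (hα : 1 / 2 ≤ α) : WGamma α = {x | x ∈ T₂' α ∧ 0 ≤ R α x} := by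
  rw [WGamma_eq_dslope hα]
  ext x
  exact and_congr_right fun hx =>
    (R_nonneg_iff (by linarith) (T₂'_subset_seriesDomain (by linarith) hx)).symm

theorem A₀_eq_union (hα : 1 / 2 ≤ α) : A₀ 2 1 α = T₁ α ∪ WGamma α := by
  have hα0 : 0 < α := by linarith
  refine subset_antisymm (fun x hx => (A₀_subset hα0.le hx).imp_right fun hD => ?_) ?_
  · exact ⟨hD.1, (R_nonneg_iff hα0 hD).1 ((mem_A₀_iff hα0.le hD).1 hx)⟩
  · rintro x (hx | hx)
    · exact ⟨hx.1, fun l hl => q_nonneg_of_mem_T₁ hx hl⟩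
    · rw [WGamma_eq_R hα] at hx
      exact (mem_A₀_iff hα0.le (T₂'_subset_seriesDomain hα0.le hx.1)).2 hx.2

end Main

section Integral

variable {m : ℕ} {t u : ℝ}

theorem Gamma_add_one_add_natCast (ht : -1 < t) (m : ℕ) :
    Real.Gamma (t + (1 + m)) = Real.Gamma (t + 1) * ∏ i ∈ range m, (t + ((i : ℝ) + 1)) := by
  induction m with
  | zero => simp
  | succ m ih =>
    have hm : t + (1 + m) ≠ 0 := by linarith [m.cast_nonneg (α := ℝ)]
    rw [prod_range_succ, ← mul_assoc, ← ih, Nat.cast_succ, ← add_assoc, ← add_assoc, add_assoc t 1,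
      Real.Gamma_add_one hm]
    ring

theorem sGamma_eq_s (m : ℕ) (ht : -1 < t) : sGamma (((m : ℝ) + 1) / 2) t = s m t := by
  have hΓ : Real.Gamma (t + 1) ≠ 0 := (Real.Gamma_pos_of_pos (by linarith)).ne'
  rw [sGamma, gammaRatio, show 2 * (((m : ℝ) + 1) / 2) = 1 + m by ring,
    Gamma_add_one_add_natCast ht, div_mul_cancel_left₀ hΓ, s, div_eq_mul_inv]

theorem dslope_sGamma_eq_S (m : ℕ) (ht : -1 < t) (hu : -1 < u) :
    dslope (sGamma (((m : ℝ) + 1) / 2)) u t = S m t u := by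
  rcases eq_or_ne t u with rfl | h
  · have hev : sGamma (((m : ℝ) + 1) / 2) =ᶠ[𝓝 t] s m :=
      (eventually_gt_nhds ht).mono fun z hz => sGamma_eq_s m hz
    rw [dslope_same, hev.deriv_eq, S, if_pos rfl]
  · rw [dslope_of_ne _ h, slope_def_field, sGamma_eq_s m ht, sGamma_eq_s m hu, S, if_neg h]

theorem setOf_dslope_sGamma_eq_setOf_S (m : ℕ) {D : Set (Fin 2 → ℝ)}
    (hD : D ⊆ T₂ (((m : ℝ) + 1) / 2)) :
    {x | x ∈ D ∧ 0 ≤ dslope (sGamma (((m : ℝ) + 1) / 2)) (x 1 - ((m : ℝ) + 1) / 2)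
      (x 0 - ((m : ℝ) + 1) / 2)} =
    {x | x ∈ D ∧ 0 ≤ S m (x 0 - ((m : ℝ) + 1) / 2) (x 1 - ((m : ℝ) + 1) / 2)} := by
  ext x
  refine and_congr_right fun hx => ?_
  obtain ⟨h01, h1, -⟩ := (mem_T₂_iff (by positivity)).1 (hD hx)
  rw [dslope_sGamma_eq_S m (by linarith) (by linarith)]

theorem WGamma_eq_W (m : ℕ) : WGamma (((m : ℝ) + 1) / 2) = W m :=
  setOf_dslope_sGamma_eq_setOf_S m subset_rfl

end Integral

end Okounkov

open Okounkov in
theorem theorem6_general {α : ℝ} (hα : 1 / 2 ≤ α) :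
    A₀ 2 1 α = T₁ α ∪ WGamma α ∧
      WGamma α = {x | x ∈ T₂' α ∧ 0 ≤ dslope (sGamma α) (x 1 - α) (x 0 - α)} ∧
      (∀ x ∈ T₂' α, Summable (RTerm α x)) ∧
      WGamma α = {x | x ∈ T₂' α ∧ 0 ≤ R α x} :=
  ⟨A₀_eq_union hα, WGamma_eq_dslope hα,
    fun _ hx => summable_RTerm (by linarith) (T₂'_subset_seriesDomain (by linarith) hx),
    WGamma_eq_R hα⟩

theorem theorem6 (m : ℕ) :
    Okounkov.A₀ 2 1 (((m : ℝ) + 1) / 2) =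
        Okounkov.T₁ (((m : ℝ) + 1) / 2) ∪ Okounkov.W m ∧
      Okounkov.W m =
        {x | x ∈ Okounkov.T₂' (((m : ℝ) + 1) / 2) ∧
          0 ≤ Okounkov.S m (x 0 - ((m : ℝ) + 1) / 2) (x 1 - ((m : ℝ) + 1) / 2)} ∧
      (∀ x ∈ Okounkov.T₂' (((m : ℝ) + 1) / 2),
        Summable (Okounkov.RTerm (((m : ℝ) + 1) / 2) x)) ∧
      Okounkov.W m =
        {x | x ∈ Okounkov.T₂' (((m : ℝ) + 1) / 2) ∧
          0 ≤ Okounkov.R (((m : ℝ) + 1) / 2) x} := by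
  rw [← Okounkov.setOf_dslope_sGamma_eq_setOf_S m (Okounkov.T₂'_subset_T₂ (by positivity)),
    ← Okounkov.WGamma_eq_W]
  exact theorem6_general (by linarith [m.cast_nonneg (α := ℝ)])
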